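/- \textbf{Setting.} Let $P_{XY}$ be a probability distribution of $(X,Y)$, $X=(X_1,\dots,X_p)\in\mathbb R^p$, $Y\in\mathbb R$, with $X$-marginal $P_X$. Feature $j\in[p]$ is null if $Y\perp X_j\mid X_{-j}$; let $\mathcal H_0$ be the set of nulls. The data $(\mathbf X,\mathbf Y)\in\mathbb R^{n\times p}\times\mathbb R^n$ consist of $n$ i.i.d. samples from $P_{XY}$. Let $\kappa$ be a conditional distribution of a random matrix $\tilde{\mathbf X}\in\mathbb R^{n\times p}$ given $\mathbf X$ such that, when $\mathbf X$ has i.i.d. rows from $P_X$ and $\tilde{\mathbf X}\mid\mathbf X\sim\kappa$, for every $j$ the joint distribution of $(\mathbf X,\tilde{\mathbf X})$ is unchanged when the columns $\mathbf X_j$ and $\tilde{\mathbf X}_j$ are exchanged. Let $\mathcal W([\mathbf X,\tilde{\mathbf X}],\mathbf Y)\in\mathbb R^p$ be a measurable function such that exchanging $\mathbf X_j$ and $\tilde{\mathbf X}_j$ flips the sign of its $j$-th coordinate and leaves its other coordinates unchanged, for every $j$. \textbf{Derandomized knockoffs.} Let $\alpha_{\mathrm{kn}},\alpha_{\mathrm{ebh}}\in(0,1)$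 and $M\ge 1$. Draw $\tilde{\mathbf X}^{(1)},\dots,\tilde{\mathbf X}^{(M)}$ i.i.d. from $\kappa(\mathbf X)$ conditionally on $(\mathbf X,\mathbf Y)$, and for each $m$ let $W^{(m)}=\mathcal W([\mathbf X,\tilde{\mathbf X}^{(m)}],\mathbf Y)$. Let $T^{(m)}$ be the smallest $t$ in $\{|W^{(m)}_k|:k\in[p],\,W^{(m)}_k\ne 0\}$ with $$\frac{1+\sum_{k\in[p]}\mathbf 1\{W^{(m)}_k\le -t\}}{\sum_{k\in[p]}\mathbf 1\{W^{(m)}_k\ge t\}}\le\alpha_{\mathrm{kn}}\quad\text{or}\quad\sum_{k\in[p]}\mathbf 1\{W^{(m)}_k\ge t\}<1/\alpha_{\mathrm{kn}},$$ and $T^{(m)}=+\infty$ if there is none (a quotient with denominator $0$ is $+\infty$). For $j\in[p]$ put $$e^{(m)}_j=p\cdot\frac{\mathbf 1\{W^{(m)}_j\ge T^{(m)}\}}{1+\sum_{k\in[p]}\mathbf 1\{W^{(m)}_k\le -T^{(m)}\}},\qquad e^{\mathrm{avg}}_j=\frac1M\sum_{m=1}^M e^{(m)}_j .$$ Let $e^{\mathrm{avg}}_{(1)}\ge\dots\ge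 e^{\mathrm{avg}}_{(p)}$ be the order statistics of the $e^{\mathrm{avg}}_j$ and $\hat k=\max\{k\in[p]:e^{\mathrm{avg}}_{(k)}\ge p/(\alpha_{\mathrm{ebh}}k)\}$, with $\hat k=0$ if this set is empty. The selected set is $\mathcal S=\{j\in[p]:e^{\mathrm{avg}}_j\ge p/(\alpha_{\mathrm{ebh}}\hat k)\}$, and $\mathcal S=\emptyset$ if $\hat k=0$. \textbf{Theorem.} For all $\alpha_{\mathrm{kn}},\alpha_{\mathrm{ebh}}\in(0,1)$ and all $M\ge1$, the selected set satisfies $$\mathrm{FDR}=\mathbb E\left[\frac{|\mathcal S\cap\mathcal H_0|}{\max(|\mathcal S|,1)}\right]\le\alpha_{\mathrm{ebh}} .$$ -/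

import Mathlib

open MeasureTheory ProbabilityTheory

noncomputable section

namespace Knockoff

/-- An `n × p` real data matrix; row `i` is the `i`-th sample, column `j` the `j`-th feature. -/
abbrev Design (n p : ℕ) : Type := Fin n → Fin p → ℝ

/-! ### Hypotheses and the model -/

/-- The features other than the `j`-th one, `(x, y) ↦ x_{-j}`. -/
def others {p : ℕ} (j : Fin p) (z : (Fin p → ℝ) × ℝ) : {k : Fin p // k ≠ j} → ℝ :=
  fun k => z.1 k

lemma measurable_others {p : ℕ} (j : Fin p) : Measurable (others j) := by
  unfold others
  fun_prop

/-- The conditional independence hypothesis `H_j : Y ⟂ X_j | X_{-j}`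
for `(X, Y)` distributed as `P`. -/
def IsNull {p : ℕ} (P : Measure ((Fin p → ℝ) × ℝ)) [IsProbabilityMeasure P] (j : Fin p) : Prop :=
  CondIndepFun (MeasurableSpace.comap (others j) inferInstance) (measurable_others j).comap_le
    (fun z : (Fin p → ℝ) × ℝ => z.2) (fun z : (Fin p → ℝ) × ℝ => z.1 j) P

/-- The set of true null hypotheses. -/
def nulls {p : ℕ} (P : Measure ((Fin p → ℝ) × ℝ)) [IsProbabilityMeasure P] : Set (Fin p) :=
  {j | IsNull P j}

/-- Exchange the `j`-th columns of `x` and of `x'` in the augmented matrix `[x, x']`. -/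
def swapCol {n p : ℕ} (j : Fin p) (z : Design n p × Design n p) : Design n p × Design n p :=
  (fun i k => if k = j then z.2 i k else z.1 i k,
   fun i k => if k = j then z.1 i k else z.2 i k)

/-- `κ`, a conditional distribution of a knockoff matrix given the data matrix, is valid for the
feature distribution `PX`: when the rows of `X` are i.i.d. from `PX` and the conditional
distribution of `X'` given `X` is `κ`, the joint law of `(X, X')` does not change when `X_j` and
`X'_j` are exchanged, for every `j`. -/
def IsKnockoffKernel {n p : ℕ} (PX : Measure (Fin p → ℝ))
    (κ : Kernel (Design n p) (Design n p)) : Prop :=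
  ∀ j : Fin p,
    (Measure.compProd (Measure.pi fun _ : Fin n => PX) κ).map (swapCol j) =
      Measure.compProd (Measure.pi fun _ : Fin n => PX) κ

/-- The requirement on the feature importance statistics: exchanging `X_j` and `X'_j` flips the
sign of `W_j` and leaves the other coordinates of `W` unchanged. -/
def HasFlipSign {n p : ℕ}
    (𝒲 : (Design n p × Design n p) × (Fin n → ℝ) → (Fin p → ℝ)) : Prop :=
  ∀ (j : Fin p) (z : Design n p × Design n p) (y : Fin n → ℝ) (k : Fin p),
    𝒲 (swapCol j z, y) k = if k = j then -𝒲 (z, y) k else 𝒲 (z, y) k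

/-- `X' 1, …, X' M` are drawn i.i.d. from `κ X`, conditionally on the data `(X, Y)`. -/
def IsCondIIDSample {Ω : Type*} [MeasurableSpace Ω] (μ : Measure Ω) {n p M : ℕ}
    (κ : Kernel (Design n p) (Design n p)) (X : Ω → Design n p) (Y : Ω → Fin n → ℝ)
    (X' : Fin M → Ω → Design n p) : Prop :=
  ∀ (B : Set (Design n p × (Fin n → ℝ))) (A : Fin M → Set (Design n p)),
    MeasurableSet B → (∀ m, MeasurableSet (A m)) →
      μ {ω | (X ω, Y ω) ∈ B ∧ ∀ m, X' m ω ∈ A m} =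
        ∫⁻ ω in {ω | (X ω, Y ω) ∈ B}, ∏ m, κ (X ω) (A m) ∂μ

/-! ### The procedure -/

/-- The number of `k` with `w k ≥ t`. -/
def posCount {p : ℕ} (w : Fin p → ℝ) (t : EReal) : ℕ :=
  (Finset.univ.filter fun k => t ≤ (w k : EReal)).card

/-- The number of `k` with `w k ≤ -t`. -/
def negCount {p : ℕ} (w : Fin p → ℝ) (t : EReal) : ℕ :=
  (Finset.univ.filter fun k => (w k : EReal) ≤ -t).card

/-- The stopping criterion at `t`: the estimated false discovery proportion is at most `α`
(a quotient with denominator `0` counts as `+∞`), or fewer than `1 / α` of the statistics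
are `≥ t`. -/
def StopsAt {p : ℕ} (α : ℝ) (w : Fin p → ℝ) (t : EReal) : Prop :=
  (0 < posCount w t ∧ (1 + (negCount w t : ℝ)) / (posCount w t : ℝ) ≤ α) ∨
    (posCount w t : ℝ) < 1 / α

/-- The knockoffs threshold: the smallest `t` among the nonzero magnitudes `|w k|` that meets the
stopping criterion, and `+∞` if there is none. -/
def threshold {p : ℕ} (α : ℝ) (w : Fin p → ℝ) : EReal :=
  sInf {t : EReal | (∃ k, t = ((|w k| : ℝ) : EReal)) ∧ 0 < t ∧ StopsAt α w t}

open Classical in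
/-- The knockoff e-values computed from the statistics `w`. -/
def eValue {p : ℕ} (α : ℝ) (w : Fin p → ℝ) (j : Fin p) : ℝ :=
  p * ((if threshold α w ≤ (w j : EReal) then 1 else 0) /
    (1 + (negCount w (threshold α w) : ℝ)))

/-- The order statistics of `e` in decreasing order; `orderStat e i` is the `(i+1)`-st largest
value. -/
def orderStat {p : ℕ} (e : Fin p → ℝ) (i : Fin p) : ℝ :=
  e (Tuple.sort e i.rev)

open Classical in
/-- The largest `k ∈ {1, …, p}` whose order statistic is at least `p / (α k)`,
and `0` if there is none. -/
def eBHCount {p : ℕ} (α : ℝ) (e : Fin p → ℝ) : ℕ :=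
  (Finset.univ.filter fun i : Fin p =>
    (p : ℝ) / (α * ((i : ℕ) + 1 : ℕ)) ≤ orderStat e i).sup fun i => (i : ℕ) + 1

open Classical in
/-- The selected set of the e-BH procedure at level `α`; it is empty when `eBHCount α e = 0`. -/
def eBH {p : ℕ} (α : ℝ) (e : Fin p → ℝ) : Finset (Fin p) :=
  Finset.univ.filter fun j => 0 < eBHCount α e ∧ (p : ℝ) / (α * eBHCount α e) ≤ e j

/-- Derandomized knockoffs: the selected set computed from the data matrix `x`, the response `y`
and the knockoff copies `x' 1, …, x' M`. -/
def derandomized {n p M : ℕ} (αkn αebh : ℝ)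
    (𝒲 : (Design n p × Design n p) × (Fin n → ℝ) → (Fin p → ℝ))
    (x : Design n p) (y : Fin n → ℝ) (x' : Fin M → Design n p) : Finset (Fin p) :=
  eBH αebh fun j => (1 / (M : ℝ)) * ∑ m, eValue αkn (𝒲 ((x, x' m), y)) j

open Classical in
/-- The false discovery proportion of the selected set `S`, with `H₀` the set of true nulls. -/
def fdp {p : ℕ} (H₀ : Set (Fin p)) (S : Finset (Fin p)) : ℝ :=
  ((S.filter fun j => j ∈ H₀).card : ℝ) / (max S.card 1 : ℕ)

/-- The false discovery rate of the random selected set `S`. -/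
def fdr {Ω : Type*} [MeasurableSpace Ω] (μ : Measure Ω) {p : ℕ} (H₀ : Set (Fin p))
    (S : Ω → Finset (Fin p)) : ℝ :=
  ∫ ω, fdp H₀ (S ω) ∂μ

end Knockoff

end

/-! e-BH controls the FDR under arbitrary dependence once the null e-values have total mean at most
`p`: a selected `j` has `e j ≥ p / (α k̂)` with `k̂ ≤ |S|`, so `1 / |S| ≤ α e j / p`, and the FDP is
at most `α / p` times the sum of the null e-values (`fdp_eBH_le`). Averaging over copies preserves
the mean bound, so one copy suffices.

For one copy and a null `j`, given `X` the response depends only on `X_{-j}` and the copy is drawn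
from `X` alone. Swapping column `j` therefore preserves the joint law (`map_swapCol_eq`), and the
law of `W` is invariant under the sign flip at `j`. Hence `E e_j(W) = E e_j(flip_j W)`.

What remains is deterministic: `∑ j, e_j(flip_j w) ≤ p` for every `w` (`sum_eValue_flipSign_le`).
All nonzero terms share one threshold `t` and equal `p / negCount w t`, and at most `negCount w t`
of them occur. No martingale argument is needed. -/

namespace Knockoff

/-! ### Sign flips, the threshold and the deterministic bound on flipped e-values. -/

variable {p : ℕ} {α : ℝ}

/-- Change the sign of the `j`-th coordinate of `w`. -/
def flipSign (j : Fin p) (w : Fin p → ℝ) : Fin p → ℝ :=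
  fun k => if k = j then -w k else w k

@[simp] lemma flipSign_self (j : Fin p) (w : Fin p → ℝ) : flipSign j w j = -w j := by
  simp [flipSign]

lemma flipSign_of_ne {j k : Fin p} (h : k ≠ j) (w : Fin p → ℝ) : flipSign j w k = w k := by
  simp [flipSign, h]

lemma abs_flipSign (j : Fin p) (w : Fin p → ℝ) (k : Fin p) : |flipSign j w k| = |w k| := by
  unfold flipSign; split_ifs <;> simp

lemma measurable_flipSign (j : Fin p) : Measurable (flipSign j) := by
  refine measurable_pi_lambda _ fun k => ?_
  unfold flipSign
  split_ifs <;> fun_prop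

lemma threshold_le {w : Fin p → ℝ} {k : Fin p} (h0 : 0 < ((|w k| : ℝ) : EReal))
    (hs : StopsAt α w ((|w k| : ℝ) : EReal)) : threshold α w ≤ ((|w k| : ℝ) : EReal) :=
  sInf_le ⟨⟨k, rfl⟩, h0, hs⟩

lemma threshold_eq_top_or (α : ℝ) (w : Fin p → ℝ) :
    threshold α w = ⊤ ∨ (∃ k, threshold α w = ((|w k| : ℝ) : EReal)) ∧
      0 < threshold α w ∧ StopsAt α w (threshold α w) := by
  set s := {t : EReal | (∃ k, t = ((|w k| : ℝ) : EReal)) ∧ 0 < t ∧ StopsAt α w t} with hs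
  rcases s.eq_empty_or_nonempty with h | h
  · left; rw [threshold, ← hs, h, sInf_empty]
  · right
    have hfin : s.Finite :=
      (Set.finite_range fun k => ((|w k| : ℝ) : EReal)).subset fun t ht => by
        obtain ⟨⟨k, rfl⟩, -⟩ := ht
        exact ⟨k, rfl⟩
    exact h.csInf_mem hfin

lemma threshold_pos (α : ℝ) (w : Fin p → ℝ) : 0 < threshold α w := by
  rcases threshold_eq_top_or α w with h | h
  · rw [h]; exact EReal.zero_lt_top
  · exact h.2.1

lemma stopsAt_congr {w w' : Fin p → ℝ} {t : EReal} (hp : posCount w t = posCount w' t)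
    (hn : negCount w t = negCount w' t) : StopsAt α w t ↔ StopsAt α w' t := by
  simp only [StopsAt, hp, hn]

lemma le_neg_of_le_neg_coe {t : EReal} {x : ℝ} (h : t ≤ ((-x : ℝ) : EReal)) : (x : EReal) ≤ -t := by
  rw [EReal.le_neg]
  simpa using h

lemma not_le_of_le_neg {t : EReal} (ht : 0 < t) {x : ℝ} (h : t ≤ ((-x : ℝ) : EReal)) :
    ¬ t ≤ (x : EReal) := by
  intro h'
  have h1 : (0 : ℝ) < -x := by exact_mod_cast ht.trans_le h
  have h2 : (0 : ℝ) < x := by exact_mod_cast ht.trans_le h'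
  linarith

lemma not_neg_le_neg {t : EReal} (ht : 0 < t) {x : ℝ} (h : t ≤ ((-x : ℝ) : EReal)) :
    ¬ ((-x : ℝ) : EReal) ≤ -t := by
  intro h'
  have h2 : t ≤ ((x : ℝ) : EReal) := by
    rw [EReal.le_neg] at h'
    simpa using h'
  exact not_le_of_le_neg ht h h2

/-- The number of coordinates satisfying `Q` after flipping the sign of `j`, when `j` satisfies `Q`
exactly after the flip. -/
lemma card_flipSign_eq_add_one (Q : ℝ → Prop) [DecidablePred Q] {w : Fin p → ℝ} {j : Fin p}
    (h : Q (-w j)) (h' : ¬ Q (w j)) :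
    (Finset.univ.filter fun k => Q (flipSign j w k)).card =
      (Finset.univ.filter fun k => Q (w k)).card + 1 := by
  have : (Finset.univ.filter fun k => Q (flipSign j w k)) =
      insert j (Finset.univ.filter fun k => Q (w k)) := by
    ext k
    by_cases hk : k = j
    · subst hk; simp [h]
    · simp [flipSign_of_ne hk, hk]
  rw [this, Finset.card_insert_of_notMem (by simpa using h')]

lemma flipSign_flipSign (j : Fin p) (w : Fin p → ℝ) : flipSign j (flipSign j w) = w := by
  ext k; unfold flipSign; split_ifs <;> simp

lemma posCount_flipSign {w : Fin p → ℝ} {j : Fin p} {t : EReal} (ht : 0 < t)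
    (h : t ≤ ((-w j : ℝ) : EReal)) : posCount (flipSign j w) t = posCount w t + 1 := by
  classical
  unfold posCount
  convert card_flipSign_eq_add_one (fun x : ℝ => t ≤ (x : EReal)) h (not_le_of_le_neg ht h)

lemma negCount_flipSign {w : Fin p → ℝ} {j : Fin p} {t : EReal} (ht : 0 < t)
    (h : t ≤ ((-w j : ℝ) : EReal)) : negCount (flipSign j w) t + 1 = negCount w t := by
  classical
  -- The flip removes `j` from the negative count, so the counting lemma is applied to the flipped
  -- vector and flipped back.
  have := card_flipSign_eq_add_one (fun x : ℝ => (x : EReal) ≤ -t) (w := flipSign j w) (j := j)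
    (by simpa using le_neg_of_le_neg_coe h) (by rw [flipSign_self]; exact not_neg_le_neg ht h)
  simp only [flipSign_flipSign] at this
  unfold negCount
  convert this.symm

/-- The stopping criterion sees only the two counts at `t`. If the threshold `t` for `j` were
smaller, `t` would lie below both `-w j` and `-w k`, so either flip would give the same counts and
`t` would already stop the search for `k`. By symmetry the two thresholds agree. -/
lemma threshold_flipSign_le {w : Fin p → ℝ} {j k : Fin p}
    (hj : threshold α (flipSign j w) ≤ ((-w j : ℝ) : EReal))
    (hk : threshold α (flipSign k w) ≤ ((-w k : ℝ) : EReal)) :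
    threshold α (flipSign k w) ≤ threshold α (flipSign j w) := by
  by_contra! hlt
  have ht := threshold_pos α (flipSign j w)
  rcases threshold_eq_top_or α (flipSign j w) with h | ⟨⟨i, hi⟩, -, hs⟩
  · simp [h] at hlt
  · set t := threshold α (flipSign j w)
    have hk' : t ≤ ((-w k : ℝ) : EReal) := hlt.le.trans hk
    rw [stopsAt_congr (w' := flipSign k w)
      (by rw [posCount_flipSign ht hj, posCount_flipSign ht hk'])
      (by have := negCount_flipSign ht hj; have := negCount_flipSign ht hk'; omega)] at hs
    -- Flips preserve magnitudes, so `t` is also a candidate threshold for `flipSign k w`.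
    rw [abs_flipSign, ← abs_flipSign k] at hi
    rw [hi] at hs hlt ht
    exact absurd (threshold_le ht hs) (not_le.2 hlt)

lemma eValue_nonneg (α : ℝ) (w : Fin p → ℝ) (j : Fin p) : 0 ≤ eValue α w j := by
  unfold eValue; split_ifs <;> positivity

lemma eValue_le (α : ℝ) (w : Fin p → ℝ) (j : Fin p) : eValue α w j ≤ p := by
  unfold eValue
  refine mul_le_of_le_one_right (by positivity) (div_le_one_of_le₀ ?_ (by positivity))
  have : (0 : ℝ) ≤ negCount w (threshold α w) := by positivity
  split_ifs <;> linarith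

/-- This replaces the usual supermartingale argument; each summand uses a different flip of the same
`w`. -/
lemma sum_eValue_flipSign_le (α : ℝ) (w : Fin p → ℝ) (s : Finset (Fin p)) :
    ∑ j ∈ s, eValue α (flipSign j w) j ≤ p := by
  classical
  -- `J` collects the indices whose flipped e-value has numerator 1.
  set J := s.filter fun j => threshold α (flipSign j w) ≤ ((-w j : ℝ) : EReal) with hJ
  have hsum : ∑ j ∈ s, eValue α (flipSign j w) j = ∑ j ∈ J, eValue α (flipSign j w) j := by
    rw [hJ, Finset.sum_filter]
    refine Finset.sum_congr rfl fun j _ => ?_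
    split_ifs with h
    · rfl
    · unfold eValue
      rw [flipSign_self, if_neg h]
      simp
  rw [hsum]
  rcases J.eq_empty_or_nonempty with h0 | ⟨i, hi⟩
  · simp [h0]
  set t := threshold α (flipSign i w) with ht
  have htpos : 0 < t := threshold_pos _ _
  have heq : ∀ j ∈ J, threshold α (flipSign j w) = t := fun j hj =>
    le_antisymm (threshold_flipSign_le (Finset.mem_filter.1 hi).2 (Finset.mem_filter.1 hj).2)
      (threshold_flipSign_le (Finset.mem_filter.1 hj).2 (Finset.mem_filter.1 hi).2)
  have hle : ∀ j ∈ J, t ≤ ((-w j : ℝ) : EReal) := fun j hj =>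
    heq j hj ▸ (Finset.mem_filter.1 hj).2
  -- The `1 +` in the denominator restores exactly the coordinate that the flip removed from the
  -- negative count.
  have hval : ∀ j ∈ J, eValue α (flipSign j w) j = p * (1 / (negCount w t : ℝ)) := by
    intro j hj
    unfold eValue
    rw [heq j hj, flipSign_self, if_pos (hle j hj), ← negCount_flipSign htpos (hle j hj)]
    push_cast
    rw [add_comm]
  have hcard : J.card ≤ negCount w t := by
    refine Finset.card_le_card fun j hj => ?_
    simpa using le_neg_of_le_neg_coe (hle j hj)
  rw [Finset.sum_congr rfl hval, Finset.sum_const, nsmul_eq_mul]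
  have h1 : (J.card : ℝ) * (1 / (negCount w t : ℝ)) ≤ 1 := by
    rw [mul_one_div]
    exact div_le_one_of_le₀ (by exact_mod_cast hcard) (by positivity)
  calc (J.card : ℝ) * (p * (1 / (negCount w t : ℝ)))
      = p * ((J.card : ℝ) * (1 / (negCount w t : ℝ))) := by ring
    _ ≤ p * 1 := by gcongr
    _ = p := mul_one _

end Knockoff

/-! ### The e-BH procedure: FDP bound and measurability. -/

namespace Knockoff

variable {p : ℕ} {α : ℝ}

lemma antitone_orderStat (e : Fin p → ℝ) : Antitone (orderStat e) := fun _ _ h =>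
  Tuple.monotone_sort e (Fin.rev_le_rev.2 h)

/-- Trades the sorting permutation for a count, which serves both the size of the selected set and
measurability. -/
lemma le_orderStat_iff (e : Fin p → ℝ) (c : ℝ) (i : Fin p) :
    c ≤ orderStat e i ↔ (i : ℕ) + 1 ≤ (Finset.univ.filter fun j => c ≤ e j).card := by
  set σ : Fin p → Fin p := fun i => Tuple.sort e i.rev with hσ
  have hbij : Function.Bijective σ := (Tuple.sort e).bijective.comp Fin.rev_bijective
  constructor
  · intro h
    rw [← Fin.card_Iic, ← Finset.card_image_of_injective _ hbij.1]
    refine Finset.card_le_card fun j hj => ?_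
    obtain ⟨k, hk, rfl⟩ := Finset.mem_image.1 hj
    exact Finset.mem_filter.2
      ⟨Finset.mem_univ _, h.trans (antitone_orderStat e (Finset.mem_Iic.1 hk))⟩
  · intro h
    by_contra! hlt
    have : (Finset.univ.filter fun j => c ≤ e j).card ≤ (Finset.Iio i).card := by
      rw [← Finset.card_image_of_injective (Finset.Iio i) hbij.1]
      refine Finset.card_le_card fun j hj => ?_
      obtain ⟨k, rfl⟩ := hbij.2 j
      refine Finset.mem_image_of_mem _ (Finset.mem_Iio.2 ?_)
      by_contra! hik
      exact absurd ((Finset.mem_filter.1 hj).2.trans (antitone_orderStat e hik)) (not_le.2 hlt)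
    rw [Fin.card_Iio] at this
    omega

/-- At the maximizing index, at least `k̂` values reach the selection cutoff. The FDP bound needs
only this direction. -/
lemma eBHCount_le_card_eBH (α : ℝ) (e : Fin p → ℝ) : eBHCount α e ≤ (eBH α e).card := by
  classical
  rcases Nat.eq_zero_or_pos (eBHCount α e) with h | h
  · simp [h]
  set s := Finset.univ.filter fun i : Fin p =>
    (p : ℝ) / (α * ((i : ℕ) + 1 : ℕ)) ≤ orderStat e i with hs
  have hdef : eBHCount α e = s.sup fun i => (i : ℕ) + 1 := by
    unfold eBHCount
    congr!
  have hne : s.Nonempty := by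
    by_contra hne
    rw [Finset.not_nonempty_iff_eq_empty] at hne
    rw [hdef, hne] at h
    simp at h
  obtain ⟨i, hi, hmax⟩ := Finset.exists_mem_eq_sup s hne fun i => (i : ℕ) + 1
  have hcount : eBHCount α e = (i : ℕ) + 1 := hdef.trans hmax
  have h1 := (le_orderStat_iff e _ i).1 (Finset.mem_filter.1 hi).2
  rw [hcount]
  refine h1.trans (Finset.card_le_card fun j hj => ?_)
  simp only [eBH, Finset.mem_filter, Finset.mem_univ, true_and, hcount] at hj ⊢
  exact ⟨by omega, hj⟩

lemma fdp_nonneg (H₀ : Set (Fin p)) (S : Finset (Fin p)) : 0 ≤ fdp H₀ S := by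
  unfold fdp; positivity

lemma fdp_le_one (H₀ : Set (Fin p)) (S : Finset (Fin p)) : fdp H₀ S ≤ 1 := by
  classical
  unfold fdp
  refine div_le_one_of_le₀ ?_ (by positivity)
  exact_mod_cast (Finset.card_filter_le _ _).trans (le_max_left _ _)

open Classical in
lemma fdp_eBH_le (hα : 0 < α) (H₀ : Set (Fin p)) {e : Fin p → ℝ} (he : ∀ j, 0 ≤ e j) :
    fdp H₀ (eBH α e) ≤ α / p * ∑ j ∈ Finset.univ.filter (· ∈ H₀), e j := by
  have hcard : (((eBH α e).filter fun j => j ∈ H₀).card : ℝ) / (max (eBH α e).card 1 : ℕ) =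
      ∑ j ∈ (eBH α e).filter fun j => j ∈ H₀, 1 / ((max (eBH α e).card 1 : ℕ) : ℝ) := by
    rw [Finset.sum_const, nsmul_eq_mul, mul_one_div]
  have hfdp : fdp H₀ (eBH α e) =
      ∑ j ∈ (eBH α e).filter fun j => j ∈ H₀, 1 / ((max (eBH α e).card 1 : ℕ) : ℝ) := by
    rw [← hcard]; unfold fdp; congr!
  rw [hfdp, Finset.mul_sum]
  calc _ ≤ ∑ j ∈ (eBH α e).filter fun j => j ∈ H₀, α / p * e j := by
        refine Finset.sum_le_sum fun j hj => ?_
        have hj' := (Finset.mem_filter.1 hj).1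
        simp only [eBH, Finset.mem_filter, Finset.mem_univ, true_and] at hj'
        obtain ⟨hk, hle⟩ := hj'
        have hp : (0 : ℝ) < p := by exact_mod_cast j.pos
        have hk' : (0 : ℝ) < eBHCount α e := by exact_mod_cast hk
        have h2 : (eBHCount α e : ℝ) ≤ (max (eBH α e).card 1 : ℕ) := by
          exact_mod_cast (eBHCount_le_card_eBH α e).trans (le_max_left _ _)
        calc 1 / ((max (eBH α e).card 1 : ℕ) : ℝ) ≤ 1 / (eBHCount α e : ℝ) := by gcongr
          _ = α / p * (p / (α * eBHCount α e)) := by field_simp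
          _ ≤ α / p * e j := by gcongr
    _ ≤ _ := by
        refine Finset.sum_le_sum_of_subset_of_nonneg
          (Finset.filter_subset_filter _ (Finset.subset_univ _)) fun j _ _ => ?_
        have := he j
        positivity

/-! ### Measurability -/

variable {β : Type*} [MeasurableSpace β]

lemma measurable_card_filter {ι : Type*} [Fintype ι] {Q : β → ι → Prop}
    [∀ x, DecidablePred (Q x)] (hQ : ∀ i, MeasurableSet {x | Q x i}) :
    Measurable fun x => (Finset.univ.filter (Q x)).card := by
  classical
  simp_rw [Finset.card_filter]
  refine Finset.measurable_sum _ fun i _ => ?_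
  exact Measurable.ite (hQ i) measurable_const measurable_const

lemma measurable_posCount {w : β → Fin p → ℝ} {t : β → EReal} (hw : Measurable w)
    (ht : Measurable t) : Measurable fun x => posCount (w x) (t x) :=
  measurable_card_filter fun _ =>
    measurableSet_le ht (measurable_coe_real_ereal.comp ((measurable_pi_apply _).comp hw))

lemma measurable_negCount {w : β → Fin p → ℝ} {t : β → EReal} (hw : Measurable w)
    (ht : Measurable t) : Measurable fun x => negCount (w x) (t x) :=
  measurable_card_filter fun _ =>
    measurableSet_le (measurable_coe_real_ereal.comp ((measurable_pi_apply _).comp hw)) ht.neg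

lemma measurableSet_stopsAt {w : β → Fin p → ℝ} {t : β → EReal} (hw : Measurable w)
    (ht : Measurable t) : MeasurableSet {x | StopsAt α (w x) (t x)} := by
  have h1 := measurable_posCount hw ht
  have h2 := measurable_negCount hw ht
  have h1' : Measurable fun x => (posCount (w x) (t x) : ℝ) := measurable_from_top.comp h1
  have h2' : Measurable fun x => (negCount (w x) (t x) : ℝ) := measurable_from_top.comp h2
  exact ((measurableSet_lt measurable_const h1).inter
    (measurableSet_le ((h2'.const_add 1).div h1') measurable_const)).union
    (measurableSet_lt h1' measurable_const)

-- As a finite infimum of measurable functions, the threshold is visibly measurable.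
open Classical in
lemma threshold_eq_iInf (α : ℝ) (w : Fin p → ℝ) :
    threshold α w = ⨅ k, if 0 < ((|w k| : ℝ) : EReal) ∧ StopsAt α w ((|w k| : ℝ) : EReal)
      then ((|w k| : ℝ) : EReal) else ⊤ := by
  refine le_antisymm (le_iInf fun k => ?_) (le_sInf fun t ht => ?_)
  · split_ifs with h
    · exact threshold_le h.1 h.2
    · exact le_top
  · obtain ⟨⟨k, rfl⟩, h⟩ := ht
    refine (iInf_le _ k).trans ?_
    rw [if_pos h]

lemma measurable_threshold (α : ℝ) : Measurable fun w : Fin p → ℝ => threshold α w := by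
  classical
  simp_rw [threshold_eq_iInf]
  have habs (k : Fin p) : Measurable fun w : Fin p → ℝ => ((|w k| : ℝ) : EReal) :=
    measurable_coe_real_ereal.comp (by fun_prop)
  refine Measurable.iInf fun k => Measurable.ite ?_ (habs k) measurable_const
  exact (measurableSet_lt measurable_const (habs k)).inter
    (measurableSet_stopsAt measurable_id (habs k))

lemma measurable_eValue (α : ℝ) (j : Fin p) : Measurable fun w : Fin p → ℝ => eValue α w j := by
  classical
  unfold eValue
  have h := measurable_threshold (p := p) α
  have hn : Measurable fun w : Fin p → ℝ => (negCount w (threshold α w) : ℝ) :=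
    measurable_from_top.comp (measurable_negCount measurable_id h)
  refine (Measurable.div (Measurable.ite ?_ measurable_const measurable_const)
    (hn.const_add 1)).const_mul _
  exact measurableSet_le h (measurable_coe_real_ereal.comp (measurable_pi_apply j))

lemma measurable_eBHCount (α : ℝ) : Measurable fun e : Fin p → ℝ => eBHCount α e := by
  classical
  refine measurable_of_Iic fun N => ?_
  have : (fun e : Fin p → ℝ => eBHCount α e) ⁻¹' Set.Iic N =
      ⋂ i : Fin p, {e : Fin p → ℝ | (p : ℝ) / (α * ((i : ℕ) + 1 : ℕ)) ≤ orderStat e i →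
        (i : ℕ) + 1 ≤ N} := by
    ext e
    simp [eBHCount]
  rw [this]
  refine MeasurableSet.iInter fun i => ?_
  simp_rw [le_orderStat_iff]
  refine MeasurableSet.imp ?_ (MeasurableSet.const _)
  exact measurableSet_le measurable_const (measurable_card_filter fun j =>
    measurableSet_le measurable_const (measurable_pi_apply j))

lemma measurableSet_mem_eBH (α : ℝ) (j : Fin p) :
    MeasurableSet {e : Fin p → ℝ | j ∈ eBH α e} := by
  classical
  have h := measurable_eBHCount (p := p) α
  have h' : Measurable fun e : Fin p → ℝ => (eBHCount α e : ℝ) := measurable_from_top.comp h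
  simp only [eBH, Finset.mem_filter, Finset.mem_univ, true_and]
  exact (measurableSet_lt measurable_const h).inter
    (measurableSet_le (measurable_const.div (h'.const_mul α)) (measurable_pi_apply j))

lemma measurable_fdp_eBH (α : ℝ) (H₀ : Set (Fin p)) :
    Measurable fun e : Fin p → ℝ => fdp H₀ (eBH α e) := by
  classical
  have hcard (e : Fin p → ℝ) :
      (eBH α e).card = (Finset.univ.filter fun j => j ∈ eBH α e).card := by
    simp
  have hcard' (e : Fin p → ℝ) : ((eBH α e).filter fun j => j ∈ H₀).card =
      (Finset.univ.filter fun j => j ∈ eBH α e ∧ j ∈ H₀).card := by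
    congr 1; ext; simp
  have h1 : Measurable fun e : Fin p → ℝ => (eBH α e).card := by
    simp_rw [hcard]
    exact measurable_card_filter fun j => measurableSet_mem_eBH α j
  have h2 : Measurable fun e : Fin p → ℝ => ((eBH α e).filter fun j => j ∈ H₀).card := by
    simp_rw [hcard']
    exact measurable_card_filter fun j => (measurableSet_mem_eBH α j).inter (MeasurableSet.const _)
  have h3 : Measurable fun e : Fin p → ℝ => max (eBH α e).card 1 := h1.max measurable_const
  have h4 : Measurable fun e : Fin p → ℝ => ((max (eBH α e).card 1 : ℕ) : ℝ) :=
    measurable_from_top.comp h3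
  have h5 : Measurable fun e : Fin p → ℝ => (((eBH α e).filter fun j => j ∈ H₀).card : ℝ) :=
    measurable_from_top.comp h2
  exact h5.div h4

end Knockoff

/-! ### Invariance of the joint law under swapping a null column. -/

namespace Knockoff

open scoped ENNReal

variable {n p : ℕ}

lemma measurable_swapCol (j : Fin p) : Measurable (swapCol (n := n) j) := by
  unfold swapCol
  refine Measurable.prodMk ?_ ?_ <;>
  · refine measurable_pi_lambda _ fun i => measurable_pi_lambda _ fun k => ?_
    split_ifs <;> fun_prop

/-- Under the null hypothesis for `j`, the conditional probability of `Y ∈ C` given `X` is a function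
of `X_{-j}`. -/
lemma IsNull.exists_condProb {P : Measure ((Fin p → ℝ) × ℝ)} [IsProbabilityMeasure P] {j : Fin p}
    (h : IsNull P j) {C : Set ℝ} (hC : MeasurableSet C) :
    ∃ g : ({k : Fin p // k ≠ j} → ℝ) → ℝ≥0∞, Measurable g ∧
      ∀ A : Set (Fin p → ℝ), MeasurableSet A →
        P (A ×ˢ C) = ∫⁻ z in Prod.fst ⁻¹' A, g (others j z) ∂P := by
  classical
  have hY : Measurable fun z : (Fin p → ℝ) × ℝ => z.2 := measurable_snd
  have hXj : Measurable fun z : (Fin p → ℝ) × ℝ => z.1 j := by fun_prop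
  have hpair : Measurable fun z : (Fin p → ℝ) × ℝ => (others j z, z.1 j) :=
    (measurable_others j).prodMk hXj
  -- Almost surely, the conditional law of `Y` given `(X_{-j}, X_j)` ignores `X_j`.
  have hae := (condIndepFun_iff_condDistrib_prod_ae_eq_prodMkRight hY hXj
    (measurable_others j)).1 (CondIndepFun.symm h)
  set ρ := condDistrib (fun z : (Fin p → ℝ) × ℝ => z.2) (others j) P
  have hjoint := compProd_map_condDistrib (μ := P) (mβ := inferInstance)
    (X := fun z : (Fin p → ℝ) × ℝ => (others j z, z.1 j)) hY.aemeasurable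
  refine ⟨fun u => ρ u C, ρ.measurable_coe hC, fun A hA => ?_⟩
  -- `φ` reassembles `x` from `(x_{-j}, x_j)`, turning `X ∈ A` into an event about that pair.
  set φ : ({k : Fin p // k ≠ j} → ℝ) × ℝ → Fin p → ℝ :=
    fun u k => if hk : k = j then u.2 else u.1 ⟨k, hk⟩ with hφ
  have hφm : Measurable φ := by
    refine measurable_pi_lambda _ fun k => ?_
    by_cases hk : k = j
    · simpa only [hφ, hk, dite_true] using measurable_snd
    · simp only [hφ, hk, dite_false]
      fun_prop
  have hφ' (z : (Fin p → ℝ) × ℝ) : φ (others j z, z.1 j) = z.1 := by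
    ext k
    by_cases hk : k = j
    · subst hk; simp [hφ]
    · simp [hφ, hk, others]
  have hset : A ×ˢ C = (fun z : (Fin p → ℝ) × ℝ => ((others j z, z.1 j), z.2)) ⁻¹'
      ((φ ⁻¹' A) ×ˢ C) := by
    ext z
    simp [hφ']
  have hset' : (fun z : (Fin p → ℝ) × ℝ => (others j z, z.1 j)) ⁻¹' (φ ⁻¹' A) =
      Prod.fst ⁻¹' A := by
    ext z
    simp [hφ']
  rw [hset, ← Measure.map_apply (hpair.prodMk hY) ((hφm hA).prod hC), ← hjoint,
    Measure.compProd_congr hae, Measure.compProd_apply_prod (hφm hA) hC,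
    setLIntegral_map (hφm hA) (Kernel.measurable_coe _ hC) hpair, hset']
  rfl

/-- One knockoff copy: the joint law of the data matrix, the copy and the response. -/
lemma IsCondIIDSample.measure_single {Ω : Type*} [MeasurableSpace Ω] {μ : Measure Ω}
    {X : Ω → Design n p} {Y : Ω → Fin n → ℝ} {M : ℕ} {κ : Kernel (Design n p) (Design n p)} [IsMarkovKernel κ] {X' : Fin M → Ω → Design n p} (h : IsCondIIDSample μ κ X Y X') (m : Fin M)
    {A A' : Set (Design n p)} {C : Set (Fin n → ℝ)} (hA : MeasurableSet A)
    (hA' : MeasurableSet A') (hC : MeasurableSet C) :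
    μ {ω | X ω ∈ A ∧ X' m ω ∈ A' ∧ Y ω ∈ C} =
      ∫⁻ ω in {ω | X ω ∈ A ∧ Y ω ∈ C}, κ (X ω) A' ∂μ := by
  classical
  have := h (A ×ˢ C) (fun m' => if m' = m then A' else Set.univ) (hA.prod hC)
    (fun m' => by split_ifs <;> simp [hA'])
  have hprod (ω : Ω) :
      ∏ m', κ (X ω) (if m' = m then A' else Set.univ) = κ (X ω) A' := by
    rw [Finset.prod_eq_single m (fun b _ hb => by simp [hb]) (by simp)]
    simp
  simp_rw [hprod] at this
  refine Eq.trans (congrArg μ (Set.ext fun ω => ⟨?_, ?_⟩)) this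
  · rintro ⟨h1, h2, h3⟩
    refine ⟨⟨h1, h3⟩, fun m' => ?_⟩
    split_ifs with hm
    · exact hm ▸ h2
    · trivial
  · rintro ⟨⟨h1, h3⟩, h2⟩
    exact ⟨h1, by simpa using h2 m, h3⟩

variable {Ω : Type*} [MeasurableSpace Ω] {μ : Measure Ω} [IsProbabilityMeasure μ]
  {X : Ω → Design n p} {Y : Ω → Fin n → ℝ} {P : Measure ((Fin p → ℝ) × ℝ)}

lemma map_eq_pi_fst [IsProbabilityMeasure P] (hX : Measurable X) (hY : Measurable Y)
    (h_indep : iIndepFun (fun (i : Fin n) (ω : Ω) => (X ω i, Y ω i)) μ)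
    (h_law : ∀ i : Fin n, μ.map (fun ω => (X ω i, Y ω i)) = P) :
    μ.map X = Measure.pi fun _ : Fin n => P.fst := by
  have h1 : iIndepFun (fun (i : Fin n) (ω : Ω) => X ω i) μ :=
    h_indep.comp (fun _ => Prod.fst) fun _ => measurable_fst
  have h2 := (iIndepFun_iff_map_fun_eq_pi_map
    (fun i => ((measurable_pi_apply i).comp hX).aemeasurable)).1 h1
  have h3 (i : Fin n) : μ.map (fun ω => X ω i) = P.fst := by
    rw [← h_law i, Measure.fst, Measure.map_map measurable_fst (by fun_prop)]
    rfl
  exact h2.trans (congrArg Measure.pi (funext h3))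

/-- The joint law of the data matrix and of the event `Y ∈ ∏ i, C i`, when the conditional
probability of `Y i ∈ C i` given `X i` is `g i (X i)`. -/
lemma map_restrict_eq_withDensity [IsProbabilityMeasure P] (hX : Measurable X) (hY : Measurable Y)
    (h_indep : iIndepFun (fun (i : Fin n) (ω : Ω) => (X ω i, Y ω i)) μ)
    (h_law : ∀ i : Fin n, μ.map (fun ω => (X ω i, Y ω i)) = P)
    {C : Fin n → Set ℝ} (hC : ∀ i, MeasurableSet (C i)) {g : Fin n → (Fin p → ℝ) → ℝ≥0∞}
    (hg : ∀ i, Measurable (g i))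
    (hgC : ∀ i (A : Set (Fin p → ℝ)), MeasurableSet A →
      P (A ×ˢ C i) = ∫⁻ z in Prod.fst ⁻¹' A, g i z.1 ∂P) :
    (μ.restrict (Y ⁻¹' Set.univ.pi C)).map X =
      (Measure.pi fun _ : Fin n => P.fst).withDensity fun x => ∏ i, g i (x i) := by
  have hXi (i : Fin n) : Measurable fun ω => X ω i := (measurable_pi_apply i).comp hX
  have hYi (i : Fin n) : Measurable fun ω => Y ω i := (measurable_pi_apply i).comp hY
  have hgm : Measurable fun x : Design n p => ∏ i, g i (x i) := by fun_prop
  set ν : Fin n → Measure (Fin p → ℝ) := fun i => (P.restrict (Prod.snd ⁻¹' C i)).map Prod.fst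
  have hν (i : Fin n) {A : Set (Fin p → ℝ)} (hA : MeasurableSet A) : ν i A = P (A ×ˢ C i) := by
    rw [Measure.map_apply measurable_fst hA, Measure.restrict_apply (measurable_fst hA)]
    rfl
  -- Both sides are the product of the measures `A ↦ P (A ×ˢ C i)`: the left by independence of the
  -- rows, the right by factoring the integral of a product.
  trans Measure.pi ν
  · refine (Measure.pi_eq fun A hA => ?_).symm
    rw [Measure.map_apply hX (.univ_pi hA), Measure.restrict_apply (hX (.univ_pi hA))]
    have hset : X ⁻¹' Set.univ.pi A ∩ Y ⁻¹' Set.univ.pi C =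
        ⋂ i ∈ Finset.univ, (fun ω => (X ω i, Y ω i)) ⁻¹' (A i ×ˢ C i) := by
      ext ω
      simp [forall_and]
    rw [hset, h_indep.measure_inter_preimage_eq_mul Finset.univ
      fun i _ => (hA i).prod (hC i)]
    refine Finset.prod_congr rfl fun i _ => ?_
    rw [hν i (hA i), ← h_law i, Measure.map_apply ((hXi i).prodMk (hYi i)) ((hA i).prod (hC i))]
  · refine Measure.pi_eq fun A hA => ?_
    rw [← map_eq_pi_fst hX hY h_indep h_law, withDensity_apply _ (.univ_pi hA),
      setLIntegral_map (.univ_pi hA) hgm hX, ← lintegral_indicator (hX (.univ_pi hA))]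
    set F : Fin n → (Fin p → ℝ) × ℝ → ℝ≥0∞ := fun i => (Prod.fst ⁻¹' A i).indicator fun z => g i z.1
    have hF (i : Fin n) : Measurable (F i) :=
      ((hg i).comp measurable_fst).indicator (measurable_fst (hA i))
    have hprod (ω : Ω) : (X ⁻¹' Set.univ.pi A).indicator (fun ω => ∏ i, g i (X ω i)) ω =
        ∏ i, F i (X ω i, Y ω i) := by
      by_cases hω : ∀ i, X ω i ∈ A i
      · rw [Set.indicator_of_mem (by simpa using hω)]
        exact Finset.prod_congr rfl fun i _ => by simp [F, hω i]
      · rw [Set.indicator_of_notMem (by simpa using hω)]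
        push Not at hω
        obtain ⟨i, hi⟩ := hω
        exact (Finset.prod_eq_zero (Finset.mem_univ i) (by simp [F, hi])).symm
    simp_rw [hprod]
    have hind : iIndepFun (fun (i : Fin n) (ω : Ω) => F i (X ω i, Y ω i)) μ := h_indep.comp F hF
    rw [lintegral_prod_eq_prod_lintegral_of_indepFun Finset.univ _ hind
      fun i => (hF i).comp ((hXi i).prodMk (hYi i))]
    refine Finset.prod_congr rfl fun i _ => ?_
    rw [hν i (hA i), hgC i _ (hA i), ← lintegral_indicator (measurable_fst (hA i)),
      ← lintegral_map (hF i) ((hXi i).prodMk (hYi i)), h_law i]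

/-- For a null feature `j`, exchanging the `j`-th column of the data matrix with that of a knockoff
copy does not change the joint law with the response. -/
lemma map_swapCol_eq [IsProbabilityMeasure P] {M : ℕ} {κ : Kernel (Design n p) (Design n p)}
    [IsMarkovKernel κ] (hκ : IsKnockoffKernel P.fst κ) {X' : Fin M → Ω → Design n p}
    (hX : Measurable X) (hY : Measurable Y) (hX' : ∀ m, Measurable (X' m))
    (h_indep : iIndepFun (fun (i : Fin n) (ω : Ω) => (X ω i, Y ω i)) μ)
    (h_law : ∀ i : Fin n, μ.map (fun ω => (X ω i, Y ω i)) = P)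
    (h_sample : IsCondIIDSample μ κ X Y X') {j : Fin p} (hj : IsNull P j) (m : Fin M) :
    μ.map (fun ω => (swapCol j (X ω, X' m ω), Y ω)) = μ.map fun ω => ((X ω, X' m ω), Y ω) := by
  have hZ : Measurable fun ω => (X ω, X' m ω) := hX.prodMk (hX' m)
  have hS := measurable_swapCol (n := n) j
  set Q := Measure.compProd (Measure.pi fun _ : Fin n => P.fst) κ with hQ
  have key (C : Fin n → Set ℝ) (hC : ∀ i, MeasurableSet (C i)) (D : Set (Design n p × Design n p))
      (hD : MeasurableSet D) :
      μ {ω | swapCol j (X ω, X' m ω) ∈ D ∧ Y ω ∈ Set.univ.pi C} =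
        μ {ω | (X ω, X' m ω) ∈ D ∧ Y ω ∈ Set.univ.pi C} := by
    have hCm : MeasurableSet (Set.univ.pi C) := .univ_pi hC
    choose g hg hgC using fun i => hj.exists_condProb (hC i)
    set res : (Fin p → ℝ) → {k : Fin p // k ≠ j} → ℝ := fun x k => x k with hres
    have hresm : Measurable res := by fun_prop
    set G : Design n p → ℝ≥0∞ := fun x => ∏ i, g i (res (x i)) with hG
    have hGm : Measurable G := by fun_prop
    have hdens : (μ.restrict (Y ⁻¹' Set.univ.pi C)).map X =
        (Measure.pi fun _ : Fin n => P.fst).withDensity G :=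
      map_restrict_eq_withDensity (g := fun i x => g i (res x)) hX hY h_indep h_law hC
        (fun i => (hg i).comp hresm) hgC
    -- Given `(X, Y)` the copy has law `κ X`, so restricting to the event on `Y` only reweights `Q`
    -- by a function of `X`.
    have hmap : (μ.restrict (Y ⁻¹' Set.univ.pi C)).map (fun ω => (X ω, X' m ω)) =
        Q.withDensity fun z => G z.1 := by
      refine Measure.ext_prod fun {A A'} hA hA' => ?_
      rw [Measure.map_apply hZ (hA.prod hA'), Measure.restrict_apply (hZ (hA.prod hA'))]
      have h1 := h_sample.measure_single m hA hA' hCm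
      have hset : (fun ω => (X ω, X' m ω)) ⁻¹' A ×ˢ A' ∩ Y ⁻¹' Set.univ.pi C =
          {ω | X ω ∈ A ∧ X' m ω ∈ A' ∧ Y ω ∈ Set.univ.pi C} := by
        ext ω
        simp only [Set.mem_inter_iff, Set.mem_preimage, Set.mem_prod, Set.mem_ofPred_eq, and_assoc]
      have hset' : {ω | X ω ∈ A ∧ Y ω ∈ Set.univ.pi C} = X ⁻¹' A ∩ Y ⁻¹' Set.univ.pi C := rfl
      rw [hset, h1, hset', ← Measure.restrict_restrict (hX hA),
        ← setLIntegral_map hA (κ.measurable_coe hA') hX, hdens,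
        setLIntegral_withDensity_eq_setLIntegral_mul _ hGm (κ.measurable_coe hA') hA,
        withDensity_apply _ (hA.prod hA'), hQ,
        Measure.setLIntegral_compProd (f := fun z => G z.1) (hGm.comp measurable_fst) hA hA']
      refine lintegral_congr fun x => ?_
      simp
    have hGswap (z : Design n p × Design n p) : G (swapCol j z).1 = G z.1 := by
      refine Finset.prod_congr rfl fun i _ => ?_
      congr 1
      ext k
      simp [hres, swapCol, k.2]
    have hG1 : Measurable fun z : Design n p × Design n p => G z.1 := hGm.comp measurable_fst
    -- `Q` is swap-invariant by `hκ`; the density is too, since it reads only columns other than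
    -- `j`.
    have hinv : (Q.withDensity fun z => G z.1) (swapCol j ⁻¹' D) =
        (Q.withDensity fun z => G z.1) D := by
      rw [withDensity_apply _ (hS hD), withDensity_apply _ hD]
      conv_rhs => rw [hQ, ← hκ j, ← hQ, setLIntegral_map hD hG1 hS]
      exact setLIntegral_congr_fun (hS hD) fun z _ => (hGswap z).symm
    rw [← hmap, Measure.map_apply hZ (hS hD), Measure.map_apply hZ hD,
      Measure.restrict_apply (hZ (hS hD)), Measure.restrict_apply (hZ hD)] at hinv
    exact hinv
  have hSZ : Measurable fun ω => swapCol j (X ω, X' m ω) := hS.comp hZ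
  refine Measure.ext_prod fun {D C} hD hC => ?_
  -- With `D` fixed, both sides are finite measures in `Y`, so agreement on boxes and on total mass
  -- suffices.
  have hslice : (μ.restrict ((fun ω => swapCol j (X ω, X' m ω)) ⁻¹' D)).map Y =
      (μ.restrict ((fun ω => (X ω, X' m ω)) ⁻¹' D)).map Y := by
    refine ext_of_generate_finite _ generateFrom_pi.symm isPiSystem_pi ?_ ?_
    · rintro _ ⟨C, hC, rfl⟩
      have hC' : ∀ i, MeasurableSet (C i) := fun i => hC i (Set.mem_univ i)
      have hCm : MeasurableSet (Set.univ.pi C) := .univ_pi hC'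
      rw [Measure.map_apply hY hCm, Measure.map_apply hY hCm, Measure.restrict_apply (hY hCm),
        Measure.restrict_apply (hY hCm), Set.inter_comm, Set.inter_comm (Y ⁻¹' _)]
      exact key C hC' D hD
    · have := key (fun _ => Set.univ) (fun _ => .univ) D hD
      rw [Measure.map_apply hY .univ, Measure.map_apply hY .univ]
      simp only [Set.preimage_univ, Measure.restrict_apply_univ]
      simp only [Set.pi_univ, Set.mem_univ, and_true] at this
      exact this
  have h2 := congrArg (fun ν => ν C) hslice
  simp only [Measure.map_apply hY hC, Measure.restrict_apply (hY hC)] at h2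
  rw [Measure.map_apply (hSZ.prodMk hY) (hD.prod hC), Measure.map_apply (hZ.prodMk hY) (hD.prod hC)]
  rw [Set.inter_comm, Set.inter_comm (Y ⁻¹' _)] at h2
  exact h2

end Knockoff

/-! ### Mean of the null e-values and conclusion. -/

namespace Knockoff

variable {p : ℕ}

lemma HasFlipSign.apply_swapCol {n : ℕ}
    {𝒲 : (Design n p × Design n p) × (Fin n → ℝ) → (Fin p → ℝ)} (h : HasFlipSign 𝒲) (j : Fin p)
    (z : Design n p × Design n p) (y : Fin n → ℝ) :
    𝒲 (swapCol j z, y) = flipSign j (𝒲 (z, y)) :=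
  funext fun k => h j z y k

variable {Ω : Type*} [MeasurableSpace Ω] {μ : Measure Ω} [IsProbabilityMeasure μ]

lemma integrable_eValue (α : ℝ) {W : Ω → Fin p → ℝ} (hW : Measurable W) (j : Fin p) :
    Integrable (fun ω => eValue α (W ω) j) μ := by
  refine Integrable.of_bound ((measurable_eValue α j).comp hW).aestronglyMeasurable p
    (ae_of_all _ fun ω => ?_)
  rw [Real.norm_of_nonneg (eValue_nonneg _ _ _)]
  exact eValue_le _ _ _

/-- The null e-values have total mean at most `p` as soon as the law of the statistics is invariant
under every single null sign flip. -/
lemma sum_integral_eValue_le (α : ℝ) {W : Ω → Fin p → ℝ} (hW : Measurable W) (s : Finset (Fin p))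
    (hs : ∀ j ∈ s, μ.map (fun ω => flipSign j (W ω)) = μ.map W) :
    ∑ j ∈ s, ∫ ω, eValue α (W ω) j ∂μ ≤ p := by
  have hflip (j : Fin p) : Measurable fun ω => flipSign j (W ω) := (measurable_flipSign j).comp hW
  -- Each term gets its own flip, so single-flip invariance is enough and the deterministic bound
  -- applies pointwise.
  have h1 : ∀ j ∈ s, ∫ ω, eValue α (W ω) j ∂μ = ∫ ω, eValue α (flipSign j (W ω)) j ∂μ := by
    intro j hj
    have hm := (measurable_eValue (p := p) α j).aestronglyMeasurable (μ := μ.map W)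
    rw [← integral_map hW.aemeasurable hm, ← hs j hj,
      integral_map (hflip j).aemeasurable (by rw [hs j hj]; exact hm)]
  rw [Finset.sum_congr rfl h1, ← integral_finsetSum _ fun j _ => integrable_eValue α (hflip j) j]
  calc _ ≤ ∫ _, (p : ℝ) ∂μ :=
        integral_mono (integrable_finsetSum _ fun j _ => integrable_eValue α (hflip j) j)
          (integrable_const _) fun ω => sum_eValue_flipSign_le α (W ω) s
    _ = p := by simp

end Knockoff

theorem theorem3 {n p M : ℕ} (hM : 1 ≤ M) (αkn αebh : ℝ)
    (hkn : αkn ∈ Set.Ioo (0 : ℝ) 1) (hebh : αebh ∈ Set.Ioo (0 : ℝ) 1)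
    -- the law of `(X, Y)` for one sample
    (P : Measure ((Fin p → ℝ) × ℝ)) [IsProbabilityMeasure P]
    -- the conditional distribution of a knockoff matrix
    (κ : Kernel (Knockoff.Design n p) (Knockoff.Design n p)) [IsMarkovKernel κ]
    (hκ : Knockoff.IsKnockoffKernel P.fst κ)
    -- the feature importance statistics
    (𝒲 : (Knockoff.Design n p × Knockoff.Design n p) × (Fin n → ℝ) → (Fin p → ℝ))
    (h𝒲_meas : Measurable 𝒲) (h𝒲 : Knockoff.HasFlipSign 𝒲)
    -- the data and the knockoff copies
    {Ω : Type*} [MeasurableSpace Ω] (μ : Measure Ω) [IsProbabilityMeasure μ]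
    (X : Ω → Knockoff.Design n p) (Y : Ω → Fin n → ℝ) (X' : Fin M → Ω → Knockoff.Design n p)
    (hX : Measurable X) (hY : Measurable Y) (hX' : ∀ m, Measurable (X' m))
    (h_indep : iIndepFun (fun (i : Fin n) (ω : Ω) => (X ω i, Y ω i)) μ)
    (h_law : ∀ i : Fin n, μ.map (fun ω => (X ω i, Y ω i)) = P)
    (h_sample : Knockoff.IsCondIIDSample μ κ X Y X') :
    Integrable (fun ω => Knockoff.fdp (Knockoff.nulls P)
        (Knockoff.derandomized αkn αebh 𝒲 (X ω) (Y ω) fun m => X' m ω)) μ ∧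
      Knockoff.fdr μ (Knockoff.nulls P)
        (fun ω => Knockoff.derandomized αkn αebh 𝒲 (X ω) (Y ω) fun m => X' m ω) ≤ αebh := by
  classical
  open Knockoff in
  have hα : 0 < αebh := hebh.1
  set W : Fin M → Ω → Fin p → ℝ := fun m ω => 𝒲 ((X ω, X' m ω), Y ω)
  have hZ (m : Fin M) : Measurable fun ω => ((X ω, X' m ω), Y ω) := (hX.prodMk (hX' m)).prodMk hY
  have hW (m : Fin M) : Measurable (W m) := h𝒲_meas.comp (hZ m)
  set N : Finset (Fin p) := Finset.univ.filter (· ∈ nulls P)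
  have hinv (m : Fin M) : ∀ j ∈ N, μ.map (fun ω => flipSign j (W m ω)) = μ.map (W m) := by
    intro j hj
    have hnull : IsNull P j := (Finset.mem_filter.1 hj).2
    have h1 := map_swapCol_eq hκ hX hY hX' h_indep h_law h_sample hnull m
    have h2 := congrArg (Measure.map 𝒲) h1
    have hS : Measurable fun ω => (swapCol j (X ω, X' m ω), Y ω) :=
      ((measurable_swapCol j).comp (hX.prodMk (hX' m))).prodMk hY
    rw [Measure.map_map h𝒲_meas (hZ m), Measure.map_map h𝒲_meas hS] at h2
    have h3 : (fun ω => flipSign j (W m ω)) = 𝒲 ∘ fun ω => (swapCol j (X ω, X' m ω), Y ω) :=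
      funext fun ω => (h𝒲.apply_swapCol j _ _).symm
    rw [h3]
    exact h2
  set e : Ω → Fin p → ℝ := fun ω j => (1 / (M : ℝ)) * ∑ m, eValue αkn (W m ω) j
  have heint (j : Fin p) : Integrable (fun ω => e ω j) μ :=
    (integrable_finsetSum _ fun m _ => integrable_eValue αkn (hW m) j).const_mul _
  have hem : Measurable e := measurable_pi_lambda _ fun j =>
    (Finset.measurable_sum _ fun m _ => (measurable_eValue αkn j).comp (hW m)).const_mul _
  have he0 (ω : Ω) (j : Fin p) : 0 ≤ e ω j :=
    mul_nonneg (by positivity) (Finset.sum_nonneg fun m _ => eValue_nonneg _ _ _)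
  have hint : Integrable (fun ω => fdp (nulls P) (eBH αebh (e ω))) μ := by
    refine Integrable.of_bound ((measurable_fdp_eBH αebh _).comp hem).aestronglyMeasurable 1
      (ae_of_all _ fun ω => ?_)
    rw [Real.norm_of_nonneg (fdp_nonneg _ _)]
    exact fdp_le_one _ _
  refine ⟨hint, ?_⟩
  change ∫ ω, fdp (nulls P) (eBH αebh (e ω)) ∂μ ≤ αebh
  have hM' : (0 : ℝ) < M := by exact_mod_cast hM
  -- By linearity, the dependence between copies plays no role.
  have hmean : ∑ j ∈ N, ∫ ω, e ω j ∂μ ≤ p := by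
    have h1 (j : Fin p) :
        ∫ ω, e ω j ∂μ = (1 / (M : ℝ)) * ∑ m, ∫ ω, eValue αkn (W m ω) j ∂μ := by
      rw [← integral_finsetSum _ fun m _ => integrable_eValue αkn (hW m) j, ← integral_const_mul]
    simp_rw [h1]
    rw [← Finset.mul_sum, Finset.sum_comm]
    calc _ ≤ (1 / (M : ℝ)) * ∑ _m : Fin M, (p : ℝ) := by
          gcongr with m
          exact sum_integral_eValue_le αkn (hW m) N (hinv m)
      _ = p := by
          rw [Finset.sum_const, Finset.card_univ, Fintype.card_fin, nsmul_eq_mul]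
          field_simp
  calc _ ≤ ∫ ω, αebh / p * ∑ j ∈ N, e ω j ∂μ :=
        integral_mono hint ((integrable_finsetSum _ fun j _ => heint j).const_mul _)
          fun ω => fdp_eBH_le hα _ (he0 ω)
    _ = αebh / p * ∑ j ∈ N, ∫ ω, e ω j ∂μ := by
        rw [integral_const_mul, integral_finsetSum _ fun j _ => heint j]
    _ ≤ αebh / p * p := by gcongr
    _ ≤ αebh := by
        -- For `p = 0` the quotient `αebh / p` is `0` by convention.
        rcases Nat.eq_zero_or_pos p with h | h
        · simp [h, hα.le]
        · have : (0 : ℝ) < p := by exact_mod_cast h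
          rw [div_mul_cancel₀ _ this.ne']
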